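/- Let $p$ be a prime, let $q$ be a power of $p$, and let $\mathbb{F}_{q^2}$ be a finite field with $q^2$ elements. Let $n=\overline{n}\,p^{\nu}$ be a positive integer with $p\nmid\overline{n}$ and $\nu\ge 0$, let $\lambda\in\mathbb{F}_{q^2}$ be a nonzero element whose multiplicative order $r$ divides $q+1$, and let $\Lambda\in\mathbb{F}_{q^2}$ be the element with $\Lambda^{p^\nu}=\lambda$. For a polynomial $f(x)=a_0+a_1x+\cdots+a_kx^k$ over $\mathbb{F}_{q^2}$ of degree $k$ with $a_0\neq 0$, put $f^\dagger(x)=a_0^{-q}\sum_{i=0}^k a_i^q x^{k-i}$, and call $f$ self-conjugate-reciprocal if $f=f^\dagger$. Let $B_{\overline{n},\lambda,q^2}$ be the sum of the degrees of those monic irreducible factors of $x^{\overline{n}}-\Lambda$ over $\mathbb{F}_{q^2}$ that are self-conjugate-reciprocal. Let $M_q$ be the set of integers $\ell\ge 1$ such that $\ell$ divides $q^i+1$ for some odd positive integer $i$, and for a positive integer $m$ let $\beta(m)$ be the exponent of $2$ in the prime factorization of $m$. Let $\gamma\ge 0$ be the integer such that $2^{\gamma}\mid q+1$ and $2^{\gamma+1}\nmid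 q+1$. Then $B_{\overline{n},\lambda,q^2}=\overline{n}$ if and only if $r\in M_q$, $\overline{n}\in M_q$ and $\beta(\overline{n})+\beta(r)\le\gamma$. -/

import Mathlib

open Polynomial

/-- For a polynomial `f = a₀ + a₁ X + ⋯ + a_k X^k` of degree `k` with `a₀ ≠ 0`, over a field with
`q ^ 2` elements, the conjugate-reciprocal polynomial `a₀^(-q) * ∑ i, a_i^q X^(k-i)`. -/
noncomputable def conjRecip {F : Type*} [Field F] (q : ℕ) (f : F[X]) : F[X] :=
  C ((f.coeff 0 ^ q)⁻¹) *
    ∑ i ∈ Finset.range (f.natDegree + 1), C (f.coeff i ^ q) * X ^ (f.natDegree - i)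

/-- A polynomial is self-conjugate-reciprocal if it has a nonzero constant term and is equal to its
conjugate-reciprocal polynomial. -/
def IsSelfConjRecip {F : Type*} [Field F] (q : ℕ) (f : F[X]) : Prop :=
  f.coeff 0 ≠ 0 ∧ conjRecip q f = f

open Classical in
/-- The sum of the degrees of the self-conjugate-reciprocal polynomials among the monic irreducible
factors of `X ^ m - Λ` (`normalizedFactors` is the multiset of the monic irreducible factors). -/
noncomputable def hermitianB {F : Type*} [Field F] (q m : ℕ) (Λ : F) : ℕ :=
  (((UniqueFactorizationMonoid.normalizedFactors (X ^ m - C Λ : F[X])).filter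
    (fun g => IsSelfConjRecip q g)).map natDegree).sum

/-- The set of the positive integers that divide `q ^ i + 1` for some odd positive integer `i`. -/
def setM (q : ℕ) : Set ℕ :=
  {l | 1 ≤ l ∧ ∃ i : ℕ, 0 < i ∧ Odd i ∧ l ∣ q ^ i + 1}

section ConjRecip

variable {F : Type*} [Field F]

/-! Equality holds iff every irreducible factor of `X ^ nbar - C Lam` is self-conjugate-reciprocal.
Such a factor is the minimal polynomial of a root `α`, and its conjugate-reciprocal vanishes at `α ^
(-q)`; Frobenius orbits turn the condition into `α ^ (q ^ i + 1) = 1` for some odd `i`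
(`isSelfConjRecip_minpoly_iff_exists_odd`). Over all roots this means `r * nbar ∈ setM q`
(`forall_pow_eq_iff_mul_mem_setM`), which `mul_mem_setM_iff` splits using `r ∣ q + 1`: only the
prime 2 obstructs. -/

theorem conjRecip_coeff {q : ℕ} {f : F[X]} {j : ℕ} :
    (conjRecip q f).coeff j =
      if j ≤ f.natDegree then (f.coeff 0 ^ q)⁻¹ * f.coeff (f.natDegree - j) ^ q else 0 := by
  rw [conjRecip, coeff_C_mul, finsetSum_coeff]
  simp only [coeff_C_mul_X_pow]
  split_ifs with h
  · rw [Finset.sum_eq_single (f.natDegree - j)]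
    · rw [if_pos (by omega)]
    · intro i hi hne
      rw [Finset.mem_range] at hi
      rw [if_neg (by omega)]
    · intro hi
      rw [Finset.mem_range] at hi
      omega
  · rw [Finset.sum_eq_zero, mul_zero]
    intro i _
    rw [if_neg (by omega)]

theorem conjRecip_natDegree_le (q : ℕ) (f : F[X]) : (conjRecip q f).natDegree ≤ f.natDegree := by
  rw [natDegree_le_iff_coeff_eq_zero]
  intro j hj
  rw [conjRecip_coeff, if_neg (by omega)]

theorem conjRecip_coeff_natDegree {q : ℕ} {f : F[X]} (h : f.coeff 0 ≠ 0) :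
    (conjRecip q f).coeff f.natDegree = 1 := by
  rw [conjRecip_coeff, if_pos le_rfl, Nat.sub_self, inv_mul_cancel₀ (pow_ne_zero q h)]

theorem conjRecip_monic {q : ℕ} {f : F[X]} (h : f.coeff 0 ≠ 0) : (conjRecip q f).Monic :=
  monic_of_natDegree_le_of_coeff_eq_one _ (conjRecip_natDegree_le q f) (conjRecip_coeff_natDegree h)

theorem aeval_conjRecip_inv_pow {L : Type*} [Field L] [Algebra F L] {p e : ℕ} [ExpChar L p]
    {f : F[X]} {α : L} (hα : α ≠ 0) (h : aeval α f = 0) :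
    aeval (α ^ p ^ e)⁻¹ (conjRecip (p ^ e) f) = 0 := by
  have hβ : α ^ p ^ e ≠ 0 := pow_ne_zero _ hα
  have key : ∑ i ∈ Finset.range (f.natDegree + 1),
      algebraMap F L (f.coeff i ^ p ^ e) * (α ^ p ^ e)⁻¹ ^ (f.natDegree - i) =
      (α ^ p ^ e)⁻¹ ^ f.natDegree * (aeval α f) ^ p ^ e := by
    rw [aeval_eq_sum_range, sum_pow_char_pow, Finset.mul_sum]
    refine Finset.sum_congr rfl fun i hi => ?_
    have hi' : i ≤ f.natDegree := by
      rw [Finset.mem_range] at hi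
      omega
    rw [Algebra.smul_def, mul_pow, map_pow, ← pow_mul α, mul_comm i, pow_mul α,
      pow_sub₀ _ (inv_ne_zero hβ) hi', inv_pow _ i, inv_inv]
    ring
  rw [conjRecip, map_mul, map_sum]
  simp only [map_mul, aeval_C, map_pow (aeval _), aeval_X]
  rw [key, h, zero_pow (pow_ne_zero e (expChar_pos L p).ne'), mul_zero, mul_zero]

/-- A monic irreducible polynomial with a nonzero root `α` is self-conjugate-reciprocal if and only
if `α ^ (-q)` is a conjugate of `α`. -/
theorem isSelfConjRecip_minpoly_iff {L : Type*} [Field L] [Algebra F L] {p e : ℕ} [ExpChar L p]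
    {α : L} (hα : α ≠ 0) (hint : IsIntegral F α) :
    IsSelfConjRecip (p ^ e) (minpoly F α) ↔ IsConjRoot F α (α ^ p ^ e)⁻¹ := by
  have h0 : (minpoly F α).coeff 0 ≠ 0 := minpoly.coeff_zero_ne_zero hint hα
  have hroot := aeval_conjRecip_inv_pow (e := e) (p := p) hα (minpoly.aeval F α)
  rw [isConjRoot_iff_aeval_eq_zero hint]
  refine ⟨fun h => by rwa [h.2] at hroot, fun h => ⟨h0, ?_⟩⟩
  have hmin : minpoly F α = minpoly F (α ^ p ^ e)⁻¹ :=
    minpoly.eq_of_irreducible_of_monic (minpoly.irreducible hint) h (minpoly.monic hint)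
  refine eq_of_monic_of_dvd_of_natDegree_le (minpoly.monic hint) (conjRecip_monic h0) ?_
    (conjRecip_natDegree_le _ _)
  rw [hmin] at hroot ⊢
  exact minpoly.dvd F _ hroot

end ConjRecip

section FiniteField

variable {F : Type*} [Field F] [Fintype F] {L : Type*} [Field L] [Finite L] [Algebra F L]

theorem isConjRoot_iff_exists_pow_card_pow {x y : L} :
    IsConjRoot F x y ↔ ∃ j : ℕ, y = x ^ Fintype.card F ^ j := by
  have hpow (j : ℕ) (x : L) :
      (FiniteField.frobeniusAlgEquivOfAlgebraic F L ^ j) x = x ^ Fintype.card F ^ j := by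
    rw [AlgEquiv.coe_pow, FiniteField.coe_frobeniusAlgEquivOfAlgebraic_iterate]
  constructor
  · intro h
    obtain ⟨σ, hσ⟩ := isConjRoot_iff_exists_algEquiv.mp h.symm
    obtain ⟨j, hj⟩ := (FiniteField.bijective_frobeniusAlgEquivOfAlgebraic_pow F L).2 σ
    refine ⟨j, ?_⟩
    rw [← hσ, ← hj]
    exact hpow _ _
  · rintro ⟨j, rfl⟩
    exact (isConjRoot_iff_exists_algEquiv.mpr
      ⟨FiniteField.frobeniusAlgEquivOfAlgebraic F L ^ j, hpow j x⟩).symm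

theorem isSelfConjRecip_minpoly_iff_exists_odd {p e : ℕ} [ExpChar L p]
    (hF : Fintype.card F = (p ^ e) ^ 2) {α : L} (hα : α ≠ 0) :
    IsSelfConjRecip (p ^ e) (minpoly F α) ↔ ∃ i, Odd i ∧ α ^ ((p ^ e) ^ i + 1) = 1 := by
  rw [isSelfConjRecip_minpoly_iff hα (Algebra.IsIntegral.isIntegral α),
    isConjRoot_iff_exists_pow_card_pow, hF]
  constructor
  · rintro ⟨j, hj⟩
    have h1 : α ^ (((p ^ e) ^ 2) ^ j + p ^ e) = 1 := by
      rw [pow_add, ← hj, inv_mul_cancel₀ (pow_ne_zero _ hα)]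
    rcases j with _ | j
    · exact ⟨1, odd_one, by rw [pow_one, add_comm]; simpa using h1⟩
    -- The exponent is `q ^ (2j+2) + q = q * (q ^ (2j+1) + 1)`; injectivity of Frobenius cancels the
    -- factor `q`.
    · refine ⟨2 * j + 1, odd_two_mul_add_one j, iterateFrobenius_inj L p e ?_⟩
      rw [map_one, iterateFrobenius_def, ← pow_mul, ← h1]
      congr 1
      ring
  · rintro ⟨i, ⟨j, rfl⟩, h⟩
    refine ⟨j + 1, inv_eq_of_mul_eq_one_left ?_⟩
    calc α ^ ((p ^ e) ^ 2) ^ (j + 1) * α ^ p ^ e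
        = (α ^ ((p ^ e) ^ (2 * j + 1) + 1)) ^ p ^ e := by ring
      _ = 1 := by rw [h, one_pow]

end FiniteField

section Arithmetic

theorem pow_add_one_dvd_pow_mul_add_one (q : ℕ) {i k : ℕ} (hk : Odd k) :
    q ^ i + 1 ∣ q ^ (i * k) + 1 := by
  simpa [pow_mul] using Odd.nat_add_dvd_pow_add_pow (q ^ i) 1 hk

theorem natCast_pow_add_one_eq_mul_sum (a : ℕ) {k : ℕ} (hk : Odd k) :
    ((a ^ k + 1 : ℕ) : ℤ) = ((a + 1 : ℕ) : ℤ) * ∑ j ∈ Finset.range k, (-(a : ℤ)) ^ j := by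
  have hg := mul_neg_geom_sum (-(a : ℤ)) k
  rw [hk.neg_pow, sub_neg_eq_add, sub_neg_eq_add] at hg
  push_cast
  rw [add_comm (a : ℤ), hg, add_comm]

/-- For odd `q`, the cofactor `(q ^ i + 1) / (q + 1)` is a sum of `i` odd terms, hence odd. -/
theorem two_pow_dvd_add_one_of_dvd_pow_add_one {q i b : ℕ} (hi : Odd i)
    (h : 2 ^ b ∣ q ^ i + 1) : 2 ^ b ∣ q + 1 := by
  rcases Nat.eq_zero_or_pos b with rfl | hb
  · simp
  have hodd : Odd q := by
    by_contra hq
    rw [Nat.not_odd_iff_even] at hq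
    have h2 : 2 ∣ q ^ i + 1 := (dvd_pow_self 2 hb.ne').trans h
    have : Even (q ^ i) := hq.pow_of_ne_zero hi.pos.ne'
    rw [even_iff_two_dvd] at this
    omega
  have hz := Int.natCast_dvd_natCast.mpr h
  rw [natCast_pow_add_one_eq_mul_sum q hi] at hz
  have hs : Odd (∑ j ∈ Finset.range i, (-(q : ℤ)) ^ j) := by
    have hq : ((-(q : ℤ) : ℤ) : ZMod 2) = 1 := by
      rw [Int.cast_neg, Int.cast_natCast, ZMod.natCast_eq_one_iff_odd.mpr hodd]
      decide
    rw [← ZMod.intCast_eq_one_iff_odd, Int.cast_sum]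
    simp only [Int.cast_pow, hq, one_pow, Finset.sum_const, Finset.card_range, nsmul_eq_mul,
      mul_one]
    exact ZMod.natCast_eq_one_iff_odd.mpr hi
  have hc : IsCoprime ((2 : ℤ) ^ b) (∑ j ∈ Finset.range i, (-(q : ℤ)) ^ j) :=
    (Int.isCoprime_two_left.mpr hs).pow_left
  push_cast at hz
  exact_mod_cast hc.dvd_of_dvd_mul_right hz

theorem mul_dvd_pow_mul_add_one {q i m r : ℕ} (hi : Odd i) (hr : Odd r)
    (hm : m ∣ q ^ i + 1) (hrq : r ∣ q + 1) : r * m ∣ q ^ (i * r) + 1 := by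
  have hri : r ∣ q ^ i + 1 := by
    simpa using hrq.trans (by simpa using pow_add_one_dvd_pow_mul_add_one q (i := 1) hi)
  -- Modulo `r`, `-q ^ i` is 1, so the `r` terms add up to `r`, that is, to 0.
  have hs : (r : ℤ) ∣ ∑ j ∈ Finset.range r, (-((q ^ i : ℕ) : ℤ)) ^ j := by
    have := dvd_geom_sum₂_self (R := ℤ) (n := r) (x := -((q ^ i : ℕ) : ℤ)) (y := 1) (by
      rw [← dvd_neg]
      simpa [add_comm] using (Int.natCast_dvd_natCast.mpr hri))
    simpa using this
  rw [← Int.natCast_dvd_natCast, pow_mul, natCast_pow_add_one_eq_mul_sum _ hr, Nat.cast_mul,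
    mul_comm (r : ℤ)]
  exact mul_dvd_mul (Int.natCast_dvd_natCast.mpr hm) hs

theorem mul_mem_setM_iff {q m r γ : ℕ} (hm : 0 < m) (hrq : r ∣ q + 1)
    (hγ : 2 ^ γ ∣ q + 1) (hγ' : ¬ 2 ^ (γ + 1) ∣ q + 1) :
    r * m ∈ setM q ↔
      r ∈ setM q ∧ m ∈ setM q ∧ padicValNat 2 m + padicValNat 2 r ≤ γ := by
  have hr : 0 < r := Nat.pos_of_dvd_of_pos hrq q.succ_pos
  constructor
  · rintro ⟨-, i, hi0, hi, hd⟩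
    refine ⟨⟨hr, i, hi0, hi, (dvd_mul_right r m).trans hd⟩,
      ⟨hm, i, hi0, hi, (dvd_mul_left m r).trans hd⟩, ?_⟩
    by_contra! hlt
    refine hγ' (two_pow_dvd_add_one_of_dvd_pow_add_one hi (dvd_trans ?_ hd))
    refine (pow_dvd_pow 2 hlt).trans ?_
    rw [add_comm, pow_add]
    exact mul_dvd_mul pow_padicValNat_dvd pow_padicValNat_dvd
  · rintro ⟨-, ⟨-, i, hi0, hi, hd⟩, hle⟩
    obtain ⟨a, m', hm', rfl⟩ := Nat.exists_eq_two_pow_mul_odd hm.ne'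
    obtain ⟨b, r', hr', rfl⟩ := Nat.exists_eq_two_pow_mul_odd hr.ne'
    have hval (c s : ℕ) (hs : Odd s) : padicValNat 2 (2 ^ c * s) = c := by
      rw [padicValNat.mul (pow_ne_zero _ two_ne_zero) hs.pos.ne', padicValNat.prime_pow,
        padicValNat.eq_zero_of_not_dvd hs.not_two_dvd_nat, add_zero]
    rw [hval _ _ hm', hval _ _ hr'] at hle
    -- The extra factor `r'` gains the odd part of `r`; the power of 2 already divides `q + 1`.
    refine ⟨Nat.mul_pos hr hm, i * r', Nat.mul_pos hi0 hr'.pos, hi.mul hr', ?_⟩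
    have h2 : 2 ^ (a + b) ∣ q ^ (i * r') + 1 := ((pow_dvd_pow 2 hle).trans hγ).trans (by
      simpa using pow_add_one_dvd_pow_mul_add_one q (i := 1) (hi.mul hr'))
    have hodd : r' * m' ∣ q ^ (i * r') + 1 := mul_dvd_pow_mul_add_one hi hr'
      ((dvd_mul_left _ _).trans hd) ((dvd_mul_left _ _).trans hrq)
    have hcop : Nat.Coprime (2 ^ (a + b)) (r' * m') :=
      (Nat.coprime_two_left.mpr (hr'.mul hm')).pow_left _
    have := hcop.mul_dvd_of_dvd_of_dvd h2 hodd
    convert this using 1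
    ring

end Arithmetic

section Factors

-- All the factor degrees sum to `m` and each is positive, so no factor may be discarded.
open Classical in
theorem hermitianB_eq_iff {F : Type*} [Field F] (q : ℕ) {m : ℕ} (hm : 0 < m) (Λ : F) :
    hermitianB q m Λ = m ↔ ∀ g ∈ UniqueFactorizationMonoid.normalizedFactors (X ^ m - C Λ : F[X]),
      IsSelfConjRecip q g := by
  have hne : (X ^ m - C Λ : F[X]) ≠ 0 := X_pow_sub_C_ne_zero hm Λ
  set s := UniqueFactorizationMonoid.normalizedFactors (X ^ m - C Λ : F[X]) with hs
  have htot : (s.map natDegree).sum = m := by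
    rw [← natDegree_multiset_prod _ (UniqueFactorizationMonoid.zero_notMem_normalizedFactors _),
      natDegree_eq_of_degree_eq (degree_eq_degree_of_associated
        (UniqueFactorizationMonoid.prod_normalizedFactors hne)), natDegree_X_pow_sub_C]
  have hsplit : hermitianB q m Λ +
      ((s.filter fun g => ¬ IsSelfConjRecip q g).map natDegree).sum = m := by
    rw [hermitianB, ← hs]
    refine Eq.trans ?_ htot
    conv_rhs => rw [← Multiset.filter_add_not (fun g => IsSelfConjRecip q g) s]
    rw [Multiset.map_add, Multiset.sum_add]
  have hzero : hermitianB q m Λ = m ↔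
      ((s.filter fun g => ¬ IsSelfConjRecip q g).map natDegree).sum = 0 := by
    omega
  rw [hzero, Multiset.sum_eq_zero_iff]
  constructor
  · intro h g hg
    by_contra hn
    exact (UniqueFactorizationMonoid.irreducible_of_normalized_factor g hg).natDegree_pos.ne'
      (h _ (Multiset.mem_map_of_mem _ (Multiset.mem_filter.mpr ⟨hg, hn⟩)))
  · intro h x hx
    obtain ⟨g, hg, rfl⟩ := Multiset.mem_map.mp hx
    exact absurd (h g (Multiset.mem_filter.mp hg).1) (Multiset.mem_filter.mp hg).2

open Classical in
/-- The irreducible factors of `f` are the minimal polynomials of the roots of `f`. -/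
theorem forall_mem_normalizedFactors_iff {F L : Type*} [Field F] [Field L] [Algebra F L]
    {f : F[X]} (hf : f ≠ 0) (hsplits : (f.map (algebraMap F L)).Splits) (P : F[X] → Prop) :
    (∀ g ∈ UniqueFactorizationMonoid.normalizedFactors f, P g) ↔
      ∀ α : L, aeval α f = 0 → P (minpoly F α) := by
  constructor
  · intro h α hα
    have hint : IsIntegral F α := IsAlgebraic.isIntegral ⟨f, hf, hα⟩
    refine h _ ((Polynomial.mem_normalizedFactors_iff hf).mpr ?_)
    exact ⟨minpoly.irreducible hint, minpoly.monic hint, minpoly.dvd F α hα⟩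
  · intro h g hg
    obtain ⟨hirr, hmonic, hdvd⟩ := (Polynomial.mem_normalizedFactors_iff hf).mp hg
    have hgs : (g.map (algebraMap F L)).Splits :=
      hsplits.of_dvd (Polynomial.map_ne_zero hf) (Polynomial.map_dvd _ hdvd)
    obtain ⟨α, hα⟩ := hgs.exists_eval_eq_zero (by
      rw [degree_map]
      exact hirr.degree_pos.ne')
    rw [eval_map_algebraMap] at hα
    rw [minpoly.eq_of_irreducible_of_monic hirr hα hmonic]
    exact h α (aeval_eq_zero_of_dvd_aeval_eq_zero hdvd hα)

end Factors

/-- All `m`-th roots of an element of order `r` have an order dividing some `q ^ i + 1` with `i`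
odd if and only if `r * m` divides such a number. -/
theorem forall_pow_eq_iff_mul_mem_setM {L : Type*} [Field L] {q m r : ℕ} (hm : 0 < m) (hr : 0 < r)
    {ζ Λ : L} (hζ : IsPrimitiveRoot ζ (r * m)) (hΛ : IsPrimitiveRoot Λ r) :
    (∀ α : L, α ^ m = Λ → ∃ i, Odd i ∧ α ^ (q ^ i + 1) = 1) ↔ r * m ∈ setM q := by
  have : NeZero r := ⟨hr.ne'⟩
  have hω : IsPrimitiveRoot (ζ ^ r) m := hζ.pow (Nat.mul_pos hr hm) rfl
  constructor
  · intro h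
    obtain ⟨k, -, hk⟩ := (hζ.pow (Nat.mul_pos hr hm) (mul_comm r m)).eq_pow_of_pow_eq_one
      hΛ.pow_eq_one
    obtain ⟨i, hi, h1⟩ := h (ζ ^ k) (by rw [← hk, ← pow_mul, ← pow_mul, mul_comm])
    -- Two roots suffice. With the common exponent `N = q ^ (i * j) + 1`, their ratio, of order `m`,
    -- gives `N = m * c`; then `Λ ^ c = (ζ ^ k) ^ N = 1` gives `r ∣ c`.
    obtain ⟨j, hj, h2⟩ := h (ζ ^ k * ζ ^ r) (by
      rw [mul_pow, hω.pow_eq_one, mul_one, ← hk, ← pow_mul, ← pow_mul, mul_comm])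
    have h1' : (ζ ^ k) ^ (q ^ (i * j) + 1) = 1 :=
      orderOf_dvd_iff_pow_eq_one.mp ((orderOf_dvd_of_pow_eq_one h1).trans <|
        pow_add_one_dvd_pow_mul_add_one q hj)
    have h2' : (ζ ^ k * ζ ^ r) ^ (q ^ (i * j) + 1) = 1 :=
      orderOf_dvd_iff_pow_eq_one.mp ((orderOf_dvd_of_pow_eq_one h2).trans <|
        mul_comm i j ▸ pow_add_one_dvd_pow_mul_add_one q hi)
    rw [mul_pow, h1', one_mul] at h2'
    obtain ⟨c, hc⟩ := hω.dvd_of_pow_eq_one _ h2'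
    refine ⟨Nat.mul_pos hr hm, i * j, (hi.mul hj).pos, hi.mul hj, ?_⟩
    rw [hc, mul_comm r m]
    refine mul_dvd_mul_left m (hΛ.dvd_of_pow_eq_one c ?_)
    rw [← hk, ← h1', hc]
    ring
  · rintro ⟨-, i, -, hi, c, hc⟩ α hα
    refine ⟨i, hi, ?_⟩
    rw [hc, mul_comm r m, pow_mul, pow_mul, hα, hΛ.pow_eq_one, one_pow]

theorem splits_X_pow_sub_C_of_isCyclotomicExtension {F L : Type*} [Field F] [Field L] [Algebra F L]
    {m r : ℕ} [NeZero (r * m)] [IsCyclotomicExtension {r * m} F L] (hm : 0 < m) (hr : 0 < r)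
    {Λ : F} (hΛ : Λ ^ r = 1) : ((X ^ m - C Λ : F[X]).map (algebraMap F L)).Splits := by
  have hne : (X ^ (r * m) - 1 : F[X]) ≠ 0 := by
    simpa using X_pow_sub_C_ne_zero (Nat.mul_pos hr hm) (1 : F)
  refine (IsCyclotomicExtension.splits_X_pow_sub_one F L (S := {r * m}) rfl).of_dvd
    (map_ne_zero hne) (Polynomial.map_dvd _ ?_)
  have := sub_dvd_pow_sub_pow (X ^ m : F[X]) (C Λ) r
  rwa [← pow_mul, ← C_pow, hΛ, C_1, mul_comm m] at this

theorem corollary4 {F : Type*} [Field F] [Fintype F]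
    (p q : ℕ) (hp : p.Prime) (hchar : CharP F p) (hF : Fintype.card F = q ^ 2)
    (n nbar ν : ℕ) (hn : 0 < n) (hnbar : n = nbar * p ^ ν) (hcop : ¬ p ∣ nbar)
    (lam Lam : F) (hlam : lam ≠ 0) (hLam : Lam ^ p ^ ν = lam)
    (r : ℕ) (hr : orderOf lam = r) (hrq : r ∣ q + 1)
    (γ : ℕ) (hγ : 2 ^ γ ∣ q + 1) (hγ' : ¬ 2 ^ (γ + 1) ∣ q + 1) :
    hermitianB q nbar Lam = nbar ↔
      (r ∈ setM q ∧ nbar ∈ setM q ∧ padicValNat 2 nbar + padicValNat 2 r ≤ γ) := by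
  have hm : 0 < nbar := by
    rcases Nat.eq_zero_or_pos nbar with rfl | h
    · exact absurd (dvd_zero p) hcop
    · exact h
  have hr0 : 0 < r := Nat.pos_of_dvd_of_pos hrq q.succ_pos
  obtain ⟨e, rfl⟩ : ∃ e, q = p ^ e := by
    obtain ⟨k, -, hk⟩ := FiniteField.card F p
    obtain ⟨e, -, he⟩ := (Nat.dvd_prime_pow hp).mp (hk ▸ hF ▸ dvd_pow_self q two_ne_zero)
    exact ⟨e, he⟩
  have he : e ≠ 0 := by
    rintro rfl
    have := Fintype.one_lt_card (α := F)
    simp at hF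
    omega
  have hpr : ¬ p ∣ r := fun h => hp.one_lt.ne' <| Nat.dvd_one.mp <|
    (Nat.dvd_add_right (dvd_pow_self p he)).mp (h.trans hrq)
  have := ExpChar.prime (R := F) hp
  -- Frobenius is injective, so `Lam` has the same order as `lam`.
  have hΛr : IsPrimitiveRoot Lam r := by
    refine IsPrimitiveRoot.of_map_of_injective (f := iterateFrobenius F p ν) ?_
      (iterateFrobenius_inj F p ν)
    rw [iterateFrobenius_def, hLam, ← hr]
    exact IsPrimitiveRoot.orderOf lam
  have hΛ0 : Lam ≠ 0 := (hΛr.isUnit hr0.ne').ne_zero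
  have : NeZero (r * nbar) := ⟨(Nat.mul_pos hr0 hm).ne'⟩
  have : NeZero ((r * nbar : ℕ) : F) := ⟨by
    rw [Ne, CharP.cast_eq_zero_iff F p, hp.dvd_mul]
    tauto⟩
  let L := CyclotomicField (r * nbar) F
  have : Module.Finite F L := IsCyclotomicExtension.finite {r * nbar} F L
  have : Finite L := Module.finite_of_finite F
  have : ExpChar L p := expChar_of_injective_algebraMap (algebraMap F L).injective p
  have hζ := IsCyclotomicExtension.zeta_spec (r * nbar) F L
  have hΛL : IsPrimitiveRoot (algebraMap F L Lam) r := hΛr.map_of_injective (algebraMap F L).injective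
  have hne : (X ^ nbar - C Lam : F[X]) ≠ 0 := X_pow_sub_C_ne_zero hm Lam
  have hsplits := splits_X_pow_sub_C_of_isCyclotomicExtension (L := L) hm hr0 hΛr.pow_eq_one
  rw [hermitianB_eq_iff _ hm, forall_mem_normalizedFactors_iff hne hsplits,
    ← mul_mem_setM_iff hm hrq hγ hγ', ← forall_pow_eq_iff_mul_mem_setM hm hr0 hζ hΛL]
  refine forall_congr' fun α => ?_
  simp only [map_sub, map_pow, aeval_X, aeval_C, sub_eq_zero]
  refine imp_congr_right fun hα => isSelfConjRecip_minpoly_iff_exists_odd hF ?_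
  rintro rfl
  rw [zero_pow hm.ne'] at hα
  exact hΛ0 ((map_eq_zero (algebraMap F L)).mp hα.symm)
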